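/- Let $(M,g,A)$ be a Kähler manifold: $M$ is a smooth $n$-dimensional manifold, $g$ a smooth Riemannian metric with Levi-Civita connection $\nabla^g$, and $A$ a smooth $(1,1)$ tensor field with $A^2=-I$, $g(AX,AY)=g(X,Y)$ and $\nabla^g A=0$. For a smooth 1-form $\pi$ let $$\nabla^1_XY=\nabla^g_XY-\pi(X)AY$$ be the quarter-symmetric metric $A$-connection with generator $\pi$, let $\nabla^2_XY=\nabla^1_YX+[X,Y]$ be its dual connection, and let $$R^2(X,Y)Z=\nabla^2_X\nabla^2_YZ-\nabla^2_Y\nabla^2_XZ-\nabla^2_{[X,Y]}Z$$ be the curvature tensor of the second kind, with Ricci tensor $Ric^2(Y,Z)=\mathrm{Trace}\{X\mapsto R^2(X,Y)Z\}$. Let $R^g$ be the curvature tensor of $\nabla^g$, $R^g(X,Y)Z=\nabla^g_X\nabla^g_YZ-\nabla^g_Y\nabla^g_XZ-\nabla^g_{[X,Y]}Z$, and $Ric^g(Y,Z)=\mathrm{Trace}\{X\mapsto R^g(X,Y)Z\}$. Then the tensor $$H^2(X,Y)Z=R^2(X,Y)Z+Ric^2(AX,Z)\,AY-Ric^2(AY,Z)\,AX$$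 is independent of the generator $\pi$ (any two smooth 1-forms give the same $H^2$), and for every smooth 1-form $\pi$ and all smooth vector fields $X,Y,Z$ $$H^2(X,Y)Z=R^g(X,Y)Z+Ric^g(AX,Z)\,AY-Ric^g(AY,Z)\,AX .$$ -/

import Mathlib

open Bundle FiberBundle VectorField
open scoped Manifold ContDiff

noncomputable section

set_option linter.unusedSectionVars false

namespace QuarterSymmetric

variable {E : Type*} [NormedAddCommGroup E] [NormedSpace ℝ E] [FiniteDimensional ℝ E]
  [CompleteSpace E] {H : Type*} [TopologicalSpace H] {I : ModelWithCorners ℝ E H}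
  {M : Type*} [TopologicalSpace M] [ChartedSpace H M] [IsManifold I ∞ M]

/-! ### The Levi-Civita connection, constructed from Koszul's formula -/

section LeviCivita

variable (g : ContMDiffRiemannianMetric I ∞ E (fun x : M ↦ TangentSpace I x))

/-- The function `g(X, Y)` on `M`. -/
def innerFun (X Y : Π x : M, TangentSpace I x) (x : M) : ℝ := g.inner x (X x) (Y x)

theorem mdiffAt_innerFun {X Y : Π x : M, TangentSpace I x} {x : M}
    (hX : MDiffAt (T% X) x) (hY : MDiffAt (T% Y) x) : MDiffAt (innerFun g X Y) x := by
  have : MDifferentiableAt I (I.prod 𝓘(ℝ))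
      (fun m ↦ TotalSpace.mk' ℝ (E := Bundle.Trivial M ℝ) m (g.inner m (X m) (Y m))) x := by
    apply MDifferentiableAt.clm_bundle_apply₂ (F₁ := E)
      (F₂ := E)
    · exact g.contMDiff.mdifferentiableAt (by simp)
    · exact hX
    · exact hY
  rw [mdifferentiableAt_totalSpace] at this
  exact this.2

theorem innerFun_comm (X Y : Π x : M, TangentSpace I x) :
    innerFun g X Y = innerFun g Y X := by
  ext y; exact g.symm y _ _

theorem innerFun_smul_left (f : M → ℝ) (X Y : Π x : M, TangentSpace I x) :
    innerFun g (f • X) Y = f * innerFun g X Y := by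
  ext y; simp [innerFun]

theorem innerFun_smul_right (f : M → ℝ) (X Y : Π x : M, TangentSpace I x) :
    innerFun g X (f • Y) = f * innerFun g X Y := by
  ext y; simp [innerFun]

theorem innerFun_add_left (X X' Y : Π x : M, TangentSpace I x) :
    innerFun g (X + X') Y = innerFun g X Y + innerFun g X' Y := by
  ext y; simp [innerFun]

theorem innerFun_add_right (X Y Y' : Π x : M, TangentSpace I x) :
    innerFun g X (Y + Y') = innerFun g X Y + innerFun g X Y' := by
  ext y; simp [innerFun]

/-- The right-hand side of Koszul's formula for `2 g(∇_X Y, Z)`, at the point `x`: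
`X g(Y, Z) + Y g(Z, X) - Z g(X, Y) + g([X, Y], Z) - g([X, Z], Y) - g([Y, Z], X)`. -/
def koszul (X Y Z : Π x : M, TangentSpace I x) (x : M) : ℝ :=
  d% (innerFun g Y Z) x (X x) + d% (innerFun g Z X) x (Y x) - d% (innerFun g X Y) x (Z x)
    + g.inner x (mlieBracket I X Y x) (Z x) - g.inner x (mlieBracket I X Z x) (Y x)
    - g.inner x (mlieBracket I Y Z x) (X x)

variable {X X' Y Y' Z Z' : Π x : M, TangentSpace I x} {f : M → ℝ} {x : M}

theorem koszul_smul_left (hX : MDiffAt (T% X) x) (hY : MDiffAt (T% Y) x)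
    (hZ : MDiffAt (T% Z) x) (hf : MDiffAt f x) :
    koszul g (f • X) Y Z x = f x * koszul g X Y Z x := by
  simp only [koszul, innerFun_smul_left, innerFun_smul_right]
  rw [mvfderiv_mul hf (mdiffAt_innerFun g hZ hX), mvfderiv_mul hf (mdiffAt_innerFun g hX hY),
    mlieBracket_smul_left hf hX, mlieBracket_smul_left hf hX]
  simp [innerFun]
  rw [g.symm x (Z x) (X x)]
  ring

theorem koszul_smul_middle (hX : MDiffAt (T% X) x) (hY : MDiffAt (T% Y) x)
    (hZ : MDiffAt (T% Z) x) (hf : MDiffAt f x) :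
    koszul g X (f • Y) Z x =
      f x * koszul g X Y Z x + 2 * (d% f x (X x) * g.inner x (Y x) (Z x)) := by
  simp only [koszul, innerFun_smul_left, innerFun_smul_right]
  rw [mvfderiv_mul hf (mdiffAt_innerFun g hX hY), mvfderiv_mul hf (mdiffAt_innerFun g hY hZ),
    mlieBracket_smul_right hf hY, mlieBracket_smul_left hf hY]
  simp [innerFun]
  rw [g.symm x (X x) (Y x)]
  ring

theorem koszul_smul_right (hX : MDiffAt (T% X) x) (hY : MDiffAt (T% Y) x)
    (hZ : MDiffAt (T% Z) x) (hf : MDiffAt f x) :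
    koszul g X Y (f • Z) x = f x * koszul g X Y Z x := by
  simp only [koszul, innerFun_smul_left, innerFun_smul_right]
  rw [mvfderiv_mul hf (mdiffAt_innerFun g hZ hX), mvfderiv_mul hf (mdiffAt_innerFun g hY hZ),
    mlieBracket_smul_right hf hZ, mlieBracket_smul_right hf hZ]
  simp [innerFun]
  rw [g.symm x (Y x) (Z x)]
  ring

theorem koszul_add_left (hX : MDiffAt (T% X) x) (hX' : MDiffAt (T% X') x)
    (hY : MDiffAt (T% Y) x) (hZ : MDiffAt (T% Z) x) :
    koszul g (X + X') Y Z x = koszul g X Y Z x + koszul g X' Y Z x := by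
  simp only [koszul, innerFun_add_left, innerFun_add_right]
  rw [mvfderiv_add (mdiffAt_innerFun g hZ hX) (mdiffAt_innerFun g hZ hX'),
    mvfderiv_add (mdiffAt_innerFun g hX hY) (mdiffAt_innerFun g hX' hY),
    mlieBracket_add_left hX hX', mlieBracket_add_left hX hX']
  simp
  ring

theorem koszul_add_middle (hX : MDiffAt (T% X) x) (hY : MDiffAt (T% Y) x)
    (hY' : MDiffAt (T% Y') x) (hZ : MDiffAt (T% Z) x) :
    koszul g X (Y + Y') Z x = koszul g X Y Z x + koszul g X Y' Z x := by
  simp only [koszul, innerFun_add_left, innerFun_add_right]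
  rw [mvfderiv_add (mdiffAt_innerFun g hX hY) (mdiffAt_innerFun g hX hY'),
    mvfderiv_add (mdiffAt_innerFun g hY hZ) (mdiffAt_innerFun g hY' hZ),
    mlieBracket_add_right hY hY', mlieBracket_add_left hY hY']
  simp
  ring

theorem koszul_add_right (hX : MDiffAt (T% X) x) (hY : MDiffAt (T% Y) x)
    (hZ : MDiffAt (T% Z) x) (hZ' : MDiffAt (T% Z') x) :
    koszul g X Y (Z + Z') x = koszul g X Y Z x + koszul g X Y Z' x := by
  simp only [koszul, innerFun_add_left, innerFun_add_right]
  rw [mvfderiv_add (mdiffAt_innerFun g hZ hX) (mdiffAt_innerFun g hZ' hX),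
    mvfderiv_add (mdiffAt_innerFun g hY hZ) (mdiffAt_innerFun g hY hZ'),
    mlieBracket_add_right hZ hZ', mlieBracket_add_right hZ hZ']
  simp
  ring

/-- For a fixed vector field `Y`, Koszul's expression as a bilinear form on the tangent space. -/
def koszulForm (hY : MDiffAt (T% Y) x) :
    TangentSpace I x →L[ℝ] TangentSpace I x →L[ℝ] ℝ :=
  TensorialAt.mkHom₂ (I := I) (F := E) (F' := E)
    (fun X Z ↦ koszul g X Y Z x) x
    (fun _ hZ ↦ ⟨fun hf hX ↦ koszul_smul_left g hX hY hZ hf,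
      fun hX hX' ↦ koszul_add_left g hX hX' hY hZ⟩)
    (fun _ hX ↦ ⟨fun hf hZ ↦ koszul_smul_right g hX hY hZ hf,
      fun hZ hZ' ↦ koszul_add_right g hX hY hZ hZ'⟩)

theorem koszulForm_apply (hX : MDiffAt (T% X) x) (hY : MDiffAt (T% Y) x)
    (hZ : MDiffAt (T% Z) x) : koszulForm g hY (X x) (Z x) = koszul g X Y Z x :=
  TensorialAt.mkHom₂_apply _ _ hX hZ

instance instFiniteDimensionalTangentSpace (x : M) :
    FiniteDimensional ℝ (TangentSpace I x) :=
  inferInstanceAs (FiniteDimensional ℝ E)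

instance instT2SpaceTangentSpace (x : M) : T2Space (TangentSpace I x) :=
  inferInstanceAs (T2Space E)

theorem inner_injective (x : M) : Function.Injective (g.inner x) := by
  rw [injective_iff_map_eq_zero]
  intro v hv
  by_contra h
  exact (g.pos x v h).ne' (by simp [hv])

/-- The musical isomorphism `v ↦ g(v, ·)` of the tangent space at `x` onto its dual. -/
def flat (x : M) : TangentSpace I x ≃ₗ[ℝ] (TangentSpace I x →L[ℝ] ℝ) :=
  LinearEquiv.ofInjectiveOfFinrankEq (g.inner x).toLinearMap (inner_injective g x) (by
    rw [← (LinearMap.toContinuousLinearMap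
      (𝕜 := ℝ) (E := TangentSpace I x) (F' := ℝ)).finrank_eq]
    exact (Subspace.dual_finrank_eq).symm)

theorem flat_apply (x : M) (v w : TangentSpace I x) : flat g x v w = g.inner x v w := rfl

open Classical in
/-- The Levi-Civita derivative `∇Y` at `x`: the map `v ↦ ∇_v Y` determined by Koszul's formula
`2 g(∇_X Y, Z) = koszul g X Y Z`. -/
def leviCivitaFun (Y : Π x : M, TangentSpace I x) (x : M) :
    TangentSpace I x →L[ℝ] TangentSpace I x :=
  if hY : MDiffAt (T% Y) x then
    ((flat g x).symm.toLinearMap ∘ₗ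
      ((1 / 2 : ℝ) • (koszulForm g hY).toLinearMap)).toContinuousLinearMap
  else 0

/-- Koszul's formula. -/
theorem inner_leviCivitaFun (hX : MDiffAt (T% X) x) (hY : MDiffAt (T% Y) x)
    (hZ : MDiffAt (T% Z) x) :
    g.inner x (leviCivitaFun g Y x (X x)) (Z x) = 1 / 2 * koszul g X Y Z x := by
  rw [← koszulForm_apply g hX hY hZ, ← flat_apply]
  simp [leviCivitaFun, hY]

theorem eq_of_inner_extend {v w : TangentSpace I x}
    (h : ∀ Z : Π x : M, TangentSpace I x, MDiffAt (T% Z) x →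
      g.inner x v (Z x) = g.inner x w (Z x)) : v = w := by
  apply inner_injective g x
  ext u
  have := h (extend E u) (mdifferentiableAt_extend ..)
  simpa using this

/-- The Levi-Civita connection of the metric `g`. -/
def leviCivita : CovariantDerivative I E
    (fun x : M ↦ TangentSpace I x) where
  toFun := leviCivitaFun g
  isCovariantDerivativeOnUniv :=
    { add := by
        intro Y Y' x hY hY' _
        ext v
        have hv := mdifferentiableAt_extend I E v
        rw [← extend_apply_self E v]
        apply eq_of_inner_extend g
        intro Z hZ
        have hYY' := mdifferentiableAt_add_section hY hY'
        rw [inner_leviCivitaFun g hv hYY' hZ, koszul_add_middle g hv hY hY' hZ]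
        simp only [add_apply, map_add]
        rw [inner_leviCivitaFun g hv hY hZ, inner_leviCivitaFun g hv hY' hZ]
        ring
      leibniz := by
        intro Y f x hY hf _
        ext v
        have hv := mdifferentiableAt_extend I E v
        rw [← extend_apply_self E v]
        apply eq_of_inner_extend g
        intro Z hZ
        have hfY := hf.smul_section hY
        rw [inner_leviCivitaFun g hv hfY hZ, koszul_smul_middle g hv hY hZ hf]
        simp only [add_apply, map_add, smul_apply,
          ContinuousLinearMap.smulRight_apply, map_smul, smul_eq_mul]
        rw [inner_leviCivitaFun g hv hY hZ]
        ring }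

/-- The Levi-Civita connection is torsion-free. -/
theorem leviCivita_torsion : (leviCivita g).torsion = 0 := by
  rw [CovariantDerivative.torsion_eq_zero_iff]
  intro X Y x hX hY
  apply eq_of_inner_extend g
  intro Z hZ
  have h1 := inner_leviCivitaFun g hX hY hZ
  have h2 := inner_leviCivitaFun g hY hX hZ
  change g.inner x (leviCivitaFun g Y x (X x) - leviCivitaFun g X x (Y x)) (Z x) = _
  simp only [map_sub, sub_apply]
  rw [h1, h2]
  simp only [koszul, innerFun_comm g Z, innerFun_comm g Y X,
    mlieBracket_swap_apply (V := Y) (W := X)]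
  simp
  ring

/-- The Levi-Civita connection is metric. -/
theorem leviCivita_metric (hX : MDiffAt (T% X) x) (hY : MDiffAt (T% Y) x)
    (hZ : MDiffAt (T% Z) x) : d% (innerFun g Y Z) x (X x) =
      g.inner x (leviCivita g Y x (X x)) (Z x) + g.inner x (Y x) (leviCivita g Z x (X x)) := by
  have h1 := inner_leviCivitaFun g hX hY hZ
  have h2 := inner_leviCivitaFun g hX hZ hY
  change _ = g.inner x (leviCivitaFun g Y x (X x)) (Z x)
    + g.inner x (Y x) (leviCivitaFun g Z x (X x))
  rw [g.symm x (Y x), h1, h2]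
  simp only [koszul, innerFun_comm g Z, innerFun_comm g Y X,
    mlieBracket_swap_apply (V := Z) (W := Y)]
  simp
  ring

end LeviCivita

/-! ### Curvature of a connection on the tangent bundle -/

/-- `X` is a `C^∞` vector field. -/
def IsSmoothField (X : Π x : M, TangentSpace I x) : Prop := CMDiff ∞ (T% X)

/-- `η` is a `C^∞` 1-form. -/
def IsSmoothOneForm (η : Π x : M, TangentSpace I x →L[ℝ] ℝ) : Prop :=
  ContMDiff I (I.prod 𝓘(ℝ, E →L[ℝ] ℝ)) ∞ (fun x ↦ TotalSpace.mk' (E →L[ℝ] ℝ) x (η x))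

/-- `A` is a `C^∞` tensor field of type (1,1). -/
def IsSmoothEndomorphism (A : Π x : M, TangentSpace I x →L[ℝ] TangentSpace I x) : Prop :=
  ContMDiff I (I.prod 𝓘(ℝ, E →L[ℝ] E)) ∞ (fun x ↦ TotalSpace.mk' (E →L[ℝ] E) x (A x))

/-- The curvature `R(X, Y)Z = ∇_X ∇_Y Z - ∇_Y ∇_X Z - ∇_{[X, Y]} Z` of a connection `D = ∇`
(recall that `D Z x (X x)` is `(∇_X Z)(x)`). -/
def curvature (D : CovariantDerivative I E (fun x : M ↦ TangentSpace I x))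
    (X Y Z : Π x : M, TangentSpace I x) (x : M) : TangentSpace I x :=
  D (fun y ↦ D Z y (Y y)) x (X x) - D (fun y ↦ D Z y (X y)) x (Y x)
    - D Z x (mlieBracket I X Y x)

open Classical in
/-- The trace of a tensorial operation from vector fields to the tangent space at `x`, that is, the
trace of the endomorphism of the tangent space that it induces (and 0 if it is not tensorial). -/
def tensorTrace (x : M) (Φ : (Π x : M, TangentSpace I x) → TangentSpace I x) : ℝ :=
  if h : TensorialAt I E Φ x then
    LinearMap.trace ℝ (TangentSpace I x) (TensorialAt.mkHom Φ x h).toLinearMap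
  else 0

/-- `Ric(Y, Z) = Trace {X ↦ R(X, Y)Z}`, for the curvature `R` of the connection `D`. -/
def ricci (D : CovariantDerivative I E (fun x : M ↦ TangentSpace I x))
    (Y Z : Π x : M, TangentSpace I x) (x : M) : ℝ :=
  tensorTrace x (fun X ↦ curvature D X Y Z x)

/-- The trace in the definition of the Ricci tensor is the trace of an honest endomorphism: for a
connection of class `C^1`, the operation `X ↦ R(X, Y)Z` is tensorial. -/
theorem curvature_tensorialAt (D : CovariantDerivative I E (fun x : M ↦ TangentSpace I x))
    [hD : CovariantDerivative.ContMDiffCovariantDerivative D 1]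
    {Y Z : Π x : M, TangentSpace I x} (hY : IsSmoothField Y) (hZ : IsSmoothField Z) (x : M) :
    TensorialAt I E (fun X ↦ curvature D X Y Z x) x := by
  have hDX : ∀ {X : Π x : M, TangentSpace I x}, MDiffAt (T% X) x →
      MDiffAt (T% (fun y ↦ D Z y (X y))) x := by
    intro X hX
    have h1 := (hD.contMDiff.contMDiff (σ := Z) ((hZ.of_le (by rw [one_add_one_eq_two]; exact ENat.LEInfty.out)).contMDiffOn))
    rw [contMDiffOn_univ] at h1
    exact (h1.mdifferentiableAt (by simp)).clm_bundle_apply hX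
  have hYx : MDiffAt (T% Y) x := hY.mdifferentiableAt (by simp)
  constructor
  · intro f X hf hX
    have e : (fun y ↦ D Z y ((f • X) y)) = f • (fun y ↦ D Z y (X y)) := by
      ext y; simp
    simp only [curvature]
    rw [e, D.isCovariantDerivativeOnUniv.leibniz (hDX hX) hf, mlieBracket_smul_left hf hX]
    simp
    module
  · intro X X' hX hX'
    have e : (fun y ↦ D Z y ((X + X') y)) = (fun y ↦ D Z y (X y)) + fun y ↦ D Z y (X' y) := by
      ext y; simp
    simp only [curvature]
    rw [e, D.isCovariantDerivativeOnUniv.add (hDX hX) (hDX hX'), mlieBracket_add_left hX hX']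
    simp
    module

/-- The dual (conjugate) connection `∇²_X Y = ∇_X Y - T(X, Y) = ∇_Y X + [X, Y]` of a connection `∇`
with torsion tensor `T`. -/
def dualConnection (D : CovariantDerivative I E (fun x : M ↦ TangentSpace I x)) :
    CovariantDerivative I E (fun x : M ↦ TangentSpace I x) :=
  D.addOneForm D.torsion

theorem dualConnection_apply (D : CovariantDerivative I E (fun x : M ↦ TangentSpace I x))
    {X Y : Π x : M, TangentSpace I x} {x : M} (hX : MDiffAt (T% X) x) (hY : MDiffAt (T% Y) x) :
    dualConnection D Y x (X x) = D X x (Y x) + mlieBracket I X Y x := by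
  change D Y x (X x) + D.torsion x (Y x) (X x) = _
  rw [D.torsion_apply hY hX, mlieBracket_swap_apply (V := Y)]
  module

/-- The curvature tensor of the second kind of a non-symmetric connection `∇`: the curvature of its
dual connection, `R²(X, Y)Z = ∇²_X ∇²_Y Z - ∇²_Y ∇²_X Z - ∇²_{[X, Y]} Z`. -/
def curvatureSecondKind (D : CovariantDerivative I E (fun x : M ↦ TangentSpace I x))
    (X Y Z : Π x : M, TangentSpace I x) : Π x : M, TangentSpace I x :=
  curvature (dualConnection D) X Y Z

/-- `Ric²(Y, Z) = Trace {X ↦ R²(X, Y)Z}`. -/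
def ricciSecondKind (D : CovariantDerivative I E (fun x : M ↦ TangentSpace I x))
    (Y Z : Π x : M, TangentSpace I x) (x : M) : ℝ :=
  tensorTrace x (fun X ↦ curvatureSecondKind D X Y Z x)

/-! ### Kähler manifolds and quarter-symmetric connections -/

/-- The vector field `AX`. -/
def applyField (A : Π x : M, TangentSpace I x →L[ℝ] TangentSpace I x)
    (X : Π x : M, TangentSpace I x) (x : M) : TangentSpace I x := A x (X x)

/-- `(g, A)` is an almost Hermitian structure on `M`. -/
structure IsAlmostHermitian
    (g : ContMDiffRiemannianMetric I ∞ E (fun x : M ↦ TangentSpace I x))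
    (A : Π x : M, TangentSpace I x →L[ℝ] TangentSpace I x) : Prop where
  smooth : IsSmoothEndomorphism A
  sq : ∀ (x : M) (v : TangentSpace I x), A x (A x v) = -v
  inner : ∀ (x : M) (v w : TangentSpace I x), g.inner x (A x v) (A x w) = g.inner x v w

/-- `(g, A)` is a Kähler structure on `M`: it is almost Hermitian, and `A` is parallel with respect
to the Levi-Civita connection, i.e. `(∇_v A)Y = ∇_v (AY) - A ∇_v Y` vanishes. -/
structure IsKahler
    (g : ContMDiffRiemannianMetric I ∞ E (fun x : M ↦ TangentSpace I x))
    (A : Π x : M, TangentSpace I x →L[ℝ] TangentSpace I x) : Prop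
    extends IsAlmostHermitian g A where
  parallel : ∀ (x : M) (Y : Π x : M, TangentSpace I x), MDiffAt (T% Y) x →
    ∀ v : TangentSpace I x,
      leviCivita g (applyField A Y) x v - A x (leviCivita g Y x v) = 0

/-- The quarter-symmetric connection `∇¹_X Y = ∇_X Y - η(X) AY` with generator `η`, where `∇` is the
Levi-Civita connection of `g`. -/
def quarterSymmetric (g : ContMDiffRiemannianMetric I ∞ E (fun x : M ↦ TangentSpace I x))
    (A : Π x : M, TangentSpace I x →L[ℝ] TangentSpace I x)
    (η : Π x : M, TangentSpace I x →L[ℝ] ℝ) :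
    CovariantDerivative I E (fun x : M ↦ TangentSpace I x) where
  toFun Y x := leviCivita g Y x - (η x).smulRight (A x (Y x))
  isCovariantDerivativeOnUniv :=
    { add := by
        intro Y Y' x hY hY' _
        rw [(leviCivita g).isCovariantDerivativeOnUniv.add hY hY']
        ext v
        simp
        module
      leibniz := by
        intro Y f x hY hf _
        rw [(leviCivita g).isCovariantDerivativeOnUniv.leibniz hY hf]
        ext v
        simp
        module }

/-- `H²(X, Y)Z = R²(X, Y)Z + Ric²(AX, Z) AY - Ric²(AY, Z) AX` for the quarter-symmetric connection
with generator `η`. -/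
def tensorH2 (g : ContMDiffRiemannianMetric I ∞ E (fun x : M ↦ TangentSpace I x))
    (A : Π x : M, TangentSpace I x →L[ℝ] TangentSpace I x)
    (η : Π x : M, TangentSpace I x →L[ℝ] ℝ)
    (X Y Z : Π x : M, TangentSpace I x) (x : M) : TangentSpace I x :=
  curvatureSecondKind (quarterSymmetric g A η) X Y Z x
    + ricciSecondKind (quarterSymmetric g A η) (applyField A X) Z x • A x (Y x)
    - ricciSecondKind (quarterSymmetric g A η) (applyField A Y) Z x • A x (X x)

end QuarterSymmetric

end

noncomputable section

set_option linter.unusedSectionVars false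

namespace QuarterSymmetric

variable {E : Type*} [NormedAddCommGroup E] [NormedSpace ℝ E] [FiniteDimensional ℝ E]
  [CompleteSpace E] {H : Type*} [TopologicalSpace H] {I : ModelWithCorners ℝ E H}
  {M : Type*} [TopologicalSpace M] [ChartedSpace H M] [IsManifold I ∞ M]

/-! ### Regularity of the Levi-Civita connection -/

section Regularity

/-! Write `∇` for the Levi-Civita connection and `ω(X) = (∇_X η)(Z) + η(Z) η(AX)`. Passing to the
dual exchanges the roles of the arguments in the perturbation: `∇²_X Y = ∇_X Y - η(Y) AX`. Since `∇A
= 0` and `∇` is torsion-free, expanding the curvature leaves `R²(X,Y)Z = R(X,Y)Z + ω(Y) AX - ω(X)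
AY` (`curvatureSecondKind_quarterSymmetric`). Trace over `X`: `A` is `g`-skew, so `tr A = 0`, and
the rank-one map `X ↦ ω(X) AY` has trace `ω(AY)`. Hence `Ric²(Y,Z) = Ric(Y,Z) - ω(AY)`
(`ricciSecondKind_quarterSymmetric`). Putting `AX` for `Y` and using `A² = -1` gives `Ric²(AX,Z) =
Ric(AX,Z) + ω(X)`, so the Ricci terms of `H²` cancel exactly the `ω` terms of `R²`. This is the
explicit formula, and its right-hand side contains no `η`.

The analytic cost is that these traces are meaningful only if curvature is tensorial, which requires
`∇` to be of class `C^1`; as `∇` is defined pointwise by Koszul's formula, its regularity has to be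
proved separately. -/

theorem contMDiffAt_mvfderiv_apply {m n : ℕ∞ω} {f : M → ℝ} {X : Π x : M, TangentSpace I x} {x : M}
    (hf : CMDiffAt n f x) (hX : CMDiffAt m (T% X) x) (hmn : m + 1 ≤ n) :
    CMDiffAt m (fun y ↦ d% f y (X y)) x := by
  have h := ContMDiffAt.clm_apply_of_inCoordinates (b₁ := id) (b₂ := f)
    (E₁ := TangentSpace I) (E₂ := TangentSpace 𝓘(ℝ, ℝ)) (ϕ := fun y ↦ mfderiv% f y)
    (ContMDiffAt.mfderiv_const hf hmn) hX (hf.of_le (le_self_add.trans hmn))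
  rw [contMDiffAt_totalSpace] at h
  have h2 := h.2
  simp at h2
  exact h2

variable (g : ContMDiffRiemannianMetric I ∞ E (fun x : M ↦ TangentSpace I x))
  {X Y Z V : Π x : M, TangentSpace I x} {x : M}

theorem contMDiffAt_innerFun {n : ℕ∞} (hX : CMDiffAt n (T% X) x) (hY : CMDiffAt n (T% Y) x) :
    CMDiffAt n (innerFun g X Y) x := by
  have : ContMDiffAt I (I.prod 𝓘(ℝ)) n
      (fun m ↦ TotalSpace.mk' ℝ (E := Bundle.Trivial M ℝ) m (g.inner m (X m) (Y m))) x := by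
    apply ContMDiffAt.clm_bundle_apply₂ (F₁ := E) (F₂ := E)
    · exact (g.contMDiff.of_le (by exact_mod_cast le_top)).contMDiffAt
    · exact hX
    · exact hY
  rw [contMDiffAt_totalSpace] at this
  exact this.2

theorem contMDiffAt_koszul (hX : CMDiffAt 2 (T% X) x) (hY : CMDiffAt 2 (T% Y) x)
    (hZ : CMDiffAt 2 (T% Z) x) : CMDiffAt 1 (koszul g X Y Z) x := by
  have h12 : (1 : ℕ∞ω) ≤ 2 := one_le_two
  have h2 : (1 : ℕ∞ω) + 1 ≤ 2 := by norm_num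
  have D : ∀ {U V W : Π x : M, TangentSpace I x}, CMDiffAt 2 (T% U) x → CMDiffAt 2 (T% V) x →
      CMDiffAt 2 (T% W) x → CMDiffAt 1 (fun y ↦ d% (innerFun g U V) y (W y)) x :=
    fun hU hV hW ↦ contMDiffAt_mvfderiv_apply (contMDiffAt_innerFun g (n := 2) hU hV)
      (hW.of_le h12) h2
  have B : ∀ {U V W : Π x : M, TangentSpace I x}, CMDiffAt 2 (T% U) x → CMDiffAt 2 (T% V) x →
      CMDiffAt 2 (T% W) x → CMDiffAt 1 (fun y ↦ g.inner y (mlieBracket I U V y) (W y)) x := by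
    intro U V W hU hV hW
    have : IsManifold I (((2 : ℕ∞) : ℕ∞ω) + 1) M :=
      IsManifold.of_le (n := ∞) (by exact_mod_cast le_top)
    have : IsManifold I (minSmoothness ℝ 2) M := by
      rw [minSmoothness_of_isRCLikeNormedField]
      infer_instance
    exact contMDiffAt_innerFun g (n := 1)
      (ContMDiffAt.mlieBracket_vectorField (m := 1) (n := 2) hU hV (by simpa using h2))
      (hW.of_le h12)
  exact (((((D hY hZ hX).add (D hZ hX hY)).sub (D hX hY hZ)).add (B hX hY hZ)).sub
    (B hX hZ hY)).sub (B hY hZ hX)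

/-- A vector field is of class `C^n` at `x` as soon as its inner products with a local frame are. -/
theorem contMDiffAt_of_innerFun {n : ℕ∞} {ι : Type*} [Fintype ι] (b : Module.Basis ι ℝ E)
    (h : ∀ i, CMDiffAt n
      (innerFun g V ((trivializationAt E (TangentSpace I) x).localFrame b i)) x) :
    CMDiffAt n (T% V) x := by
  set t := trivializationAt E (TangentSpace I : M → Type _) x
  have hx : x ∈ t.baseSet := mem_baseSet_trivializationAt E _ x
  set s := t.localFrame b
  have hs : ∀ i, CMDiffAt n (T% (s i)) x := fun i ↦ contMDiffAt_localFrame_of_mem n t b i hx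
  let c : ι → E →L[ℝ] ℝ := fun i ↦ (b.coord i).toContinuousLinearMap
  -- `G` is the metric and `θ` the covector `g(V, ·)`, both read on the fixed space `E` through the
  -- trivialization. In these coordinates `V = G⁻¹ θ`.
  let G : M → E →L[ℝ] E →L[ℝ] ℝ := fun y ↦
    ∑ i, ∑ j, innerFun g (s i) (s j) y • (c i).smulRight (c j)
  let θ : M → E →L[ℝ] ℝ := fun y ↦ ∑ j, innerFun g V (s j) y • c j
  have hG : CMDiffAt n G x := by
    apply ContMDiffAt.sum
    intro i _
    apply ContMDiffAt.sum
    intro j _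
    exact (contMDiffAt_innerFun g (hs i) (hs j)).smul contMDiffAt_const
  have hθ : CMDiffAt n θ x := by
    apply ContMDiffAt.sum
    intro i _
    exact (h i).smul contMDiffAt_const
  have hsy : ∀ y (hy : y ∈ t.baseSet) (u : TangentSpace I y),
      u = ∑ i, c i (t.continuousLinearEquivAt ℝ y hy u) • s i y := by
    intro y hy u
    apply (t.continuousLinearEquivAt ℝ y hy).injective
    rw [map_sum]
    simp only [map_smul]
    have : ∀ i, t.continuousLinearEquivAt ℝ y hy (s i y) = b i := by
      intro i
      simp only [s]
      rw [t.localFrame_apply_of_mem_baseSet b hy]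
      simp [Trivialization.basisAt, hy]
    simp only [this, c]
    exact (b.sum_repr _).symm
  have hGy : ∀ y (hy : y ∈ t.baseSet) (u w : TangentSpace I y),
      G y (t.continuousLinearEquivAt ℝ y hy u) (t.continuousLinearEquivAt ℝ y hy w)
        = g.inner y u w := by
    intro y hy u w
    conv_rhs => rw [hsy y hy u, hsy y hy w]
    simp [G, innerFun, Finset.mul_sum]
    rw [Finset.sum_comm]
    refine Finset.sum_congr rfl fun i _ ↦ Finset.sum_congr rfl fun j _ ↦ ?_
    ring
  -- Positive definiteness gives injectivity, hence invertibility by equality of dimensions.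
  have hinj : ∀ y ∈ t.baseSet, Function.Injective (G y) := by
    intro y hy
    rw [injective_iff_map_eq_zero]
    intro v hv
    obtain ⟨u, rfl⟩ := (t.continuousLinearEquivAt ℝ y hy).surjective v
    by_contra hne
    have hu : u ≠ 0 := by rintro rfl; exact hne (map_zero _)
    have := g.pos y u hu
    rw [← hGy y hy, hv] at this
    simp at this
  have hinv : ∀ y ∈ t.baseSet, ∃ e : E ≃L[ℝ] (E →L[ℝ] ℝ), (e : E →L[ℝ] E →L[ℝ] ℝ) = G y := by
    intro y hy
    refine ⟨(LinearEquiv.ofInjectiveOfFinrankEq (G y).toLinearMap (hinj y hy) (by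
      rw [← (LinearMap.toContinuousLinearMap (𝕜 := ℝ) (E := E) (F' := ℝ)).finrank_eq]
      exact (Subspace.dual_finrank_eq).symm)).toContinuousLinearEquiv, ?_⟩
    ext; rfl
  rw [contMDiffAt_section]
  -- Inversion of continuous linear maps is smooth near an invertible one, so `G⁻¹ θ` inherits the
  -- regularity of `G` and `θ`.
  have key : CMDiffAt n (fun y ↦ (G y).inverse (θ y)) x := by
    refine ContMDiffAt.clm_apply ?_ hθ
    obtain ⟨e, he⟩ := hinv x hx
    have := contDiffAt_map_inverse (n := n) e
    rw [he] at this
    exact this.contMDiffAt.comp x hG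
  refine key.congr_of_eventuallyEq ?_
  filter_upwards [t.open_baseSet.mem_nhds hx] with y hy
  obtain ⟨e, he⟩ := hinv y hy
  have h1 : θ y = e (t.continuousLinearEquivAt ℝ y hy (V y)) := by
    rw [show e (t.continuousLinearEquivAt ℝ y hy (V y))
      = (e : E →L[ℝ] E →L[ℝ] ℝ) (t.continuousLinearEquivAt ℝ y hy (V y)) from rfl, he]
    ext v
    obtain ⟨w, rfl⟩ := (t.continuousLinearEquivAt ℝ y hy).surjective v
    rw [hGy]
    conv_rhs => rw [hsy y hy w]
    simp [θ, innerFun, mul_comm]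
  rw [← he, h1]
  simp
  rfl

/-- A family of endomorphisms of the tangent spaces is of class `C^n` at `x` as soon as its values
on a local frame are. -/
theorem contMDiffAt_endomorphism_of_localFrame {n : ℕ∞} {ι : Type*} [Fintype ι]
    (b : Module.Basis ι ℝ E) {φ : Π y : M, TangentSpace I y →L[ℝ] TangentSpace I y}
    (h : ∀ i, CMDiffAt n
      (T% (fun y ↦ φ y ((trivializationAt E (TangentSpace I) x).localFrame b i y))) x) :
    ContMDiffAt I (I.prod 𝓘(ℝ, E →L[ℝ] E)) n
      (fun y ↦ TotalSpace.mk' (E →L[ℝ] E) y (φ y)) x := by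
  set t := trivializationAt E (TangentSpace I : M → Type _) x
  have hx : x ∈ t.baseSet := mem_baseSet_trivializationAt E _ x
  rw [contMDiffAt_hom_bundle]
  refine ⟨contMDiffAt_id, ?_⟩
  have key : CMDiffAt n (fun y ↦ ∑ i, (b.coord i).toContinuousLinearMap.smulRight
      (t ⟨y, φ y (t.localFrame b i y)⟩).2) x := by
    apply ContMDiffAt.sum
    intro i _
    have := h i
    rw [contMDiffAt_section] at this
    exact ((ContinuousLinearMap.smulRightL ℝ E E
      (b.coord i).toContinuousLinearMap).contMDiff.contMDiffAt).comp x this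
  refine key.congr_of_eventuallyEq ?_
  filter_upwards [t.open_baseSet.mem_nhds hx] with y hy
  apply ContinuousLinearMap.coe_injective
  refine b.ext fun i ↦ ?_
  simp only [ContinuousLinearMap.coe_coe]
  rw [ContinuousLinearMap.inCoordinates_eq hy hy]
  rw [_root_.sum_apply, Finset.sum_eq_single i]
  · simp [t.localFrame_apply_of_mem_baseSet b hy, Trivialization.basisAt, t]
  · intro j _ hj
    simp [Finsupp.single_eq_of_ne hj]
  · simp

/-- The components of `∇σ` in a local frame are determined by the inner products `g(∇_{s_i} σ,
s_j)`, which are half of Koszul's expression. That expression involves one derivative of the fields,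
so a `C^2` field `σ` yields a `C^1` result. -/
instance contMDiffCovariantDerivative_leviCivita :
    CovariantDerivative.ContMDiffCovariantDerivative (leviCivita g) 1 where
  contMDiff := ⟨by
    intro σ hσ
    rw [contMDiffOn_univ] at hσ ⊢
    intro x
    have hσ2 : CMDiff 2 (T% σ) := hσ.of_le (by norm_num)
    let b := Module.finBasis ℝ E
    have hx := mem_baseSet_trivializationAt E (TangentSpace I : M → Type _) x
    have hs : ∀ i, ∀ y ∈ (trivializationAt E (TangentSpace I : M → Type _) x).baseSet, CMDiffAt 2
        (T% ((trivializationAt E (TangentSpace I : M → Type _) x).localFrame b i)) y :=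
      fun i y hy ↦ contMDiffAt_localFrame_of_mem 2 _ b i hy
    refine contMDiffAt_endomorphism_of_localFrame (n := 1) b fun i ↦ ?_
    refine contMDiffAt_of_innerFun g (n := 1) b fun j ↦ ?_
    have hk := (contMDiffAt_const (c := (1 / 2 : ℝ)) (n := 1)).mul
      (contMDiffAt_koszul g (hs i x hx) (hσ2 x) (hs j x hx))
    refine hk.congr_of_eventuallyEq ?_
    filter_upwards [(trivializationAt E (TangentSpace I : M → Type _) x).open_baseSet.mem_nhds hx]
      with y hy
    exact inner_leviCivitaFun g ((hs i y hy).mdifferentiableAt (by simp))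
      ((hσ2 y).mdifferentiableAt (by simp)) ((hs j y hy).mdifferentiableAt (by simp))⟩

end Regularity

/-! ### The second-kind curvature of a quarter-symmetric connection -/

section Kahler

variable {g : ContMDiffRiemannianMetric I ∞ E (fun x : M ↦ TangentSpace I x)}
  {A : Π x : M, TangentSpace I x →L[ℝ] TangentSpace I x}
  {η : Π x : M, TangentSpace I x →L[ℝ] ℝ}
  {X Y Z : Π x : M, TangentSpace I x}

/-- The torsion is `T(X, Y) = η(Y) AX - η(X) AY`, and subtracting it from `∇¹` moves `η` from the
direction of differentiation to the differentiated field. -/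
theorem dualConnection_quarterSymmetric_apply (Y : Π x : M, TangentSpace I x) (x : M)
    (v : TangentSpace I x) :
    dualConnection (quarterSymmetric g A η) Y x v
      = leviCivita g Y x v - η x (Y x) • A x v := by
  set D := quarterSymmetric g A η with hD
  -- Torsion depends only on values at `x`, so it is computed on differentiable extensions of these;
  -- `Y` itself need not be differentiable.
  have hT : D.torsion x (Y x) v = η x v • A x (Y x) - η x (Y x) • A x v := by
    have hY := mdifferentiableAt_extend I E (Y x)
    have hv := mdifferentiableAt_extend I E v
    have h0 := (CovariantDerivative.torsion_eq_zero_iff _).1 (leviCivita_torsion g) hY hv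
    have h1 := D.torsion_apply hY hv
    simp only [extend_apply_self] at h0 h1
    rw [h1, ← h0]
    change (leviCivita g (extend E v) x (Y x) - η x (Y x) • A x (extend E v x)) -
      (leviCivita g (extend E (Y x)) x v - η x v • A x (extend E (Y x) x)) - _ = _
    simp only [extend_apply_self]
    module
  change (leviCivita g Y x v - η x v • A x (Y x)) + D.torsion x (Y x) v = _
  rw [hT]
  module

theorem IsSmoothField.mdifferentiableAt (hX : IsSmoothField X) (x : M) : MDiffAt (T% X) x :=
  ContMDiff.mdifferentiableAt hX (by simp)

theorem mdifferentiableAt_leviCivita_apply {x : M} (hZ : IsSmoothField Z)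
    (hX : MDiffAt (T% X) x) : MDiffAt (T% (fun y ↦ leviCivita g Z y (X y))) x := by
  have h := (contMDiffCovariantDerivative_leviCivita g).contMDiff.contMDiff (σ := Z)
    (ContMDiff.contMDiffOn (ContMDiff.of_le hZ
      (by rw [one_add_one_eq_two]; exact ENat.LEInfty.out)))
  rw [contMDiffOn_univ] at h
  exact (h.mdifferentiableAt (by simp)).clm_bundle_apply hX

theorem mdifferentiableAt_applyField {x : M} (hA : IsSmoothEndomorphism A)
    (hX : MDiffAt (T% X) x) : MDiffAt (T% (applyField A X)) x :=
  (ContMDiff.mdifferentiableAt hA (by simp)).clm_bundle_apply hX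

theorem isSmoothField_applyField (hA : IsSmoothEndomorphism A) (hX : IsSmoothField X) :
    IsSmoothField (applyField A X) :=
  fun x ↦ ContMDiffAt.clm_bundle_apply (hA x) (hX x)

theorem mdifferentiableAt_oneForm_apply {x : M} (hη : IsSmoothOneForm η)
    (hX : MDiffAt (T% X) x) : MDiffAt (fun y ↦ η y (X y)) x := by
  have h : MDifferentiableAt I (I.prod 𝓘(ℝ))
      (fun m ↦ TotalSpace.mk' ℝ (E := Bundle.Trivial M ℝ) m (η m (X m))) x :=
    (ContMDiff.mdifferentiableAt hη (by simp)).clm_bundle_apply hX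
  rw [mdifferentiableAt_totalSpace] at h
  exact h.2

/-- The 1-form `X ↦ (∇_X η)(Z) + η(Z) η(AX)`, which measures the deviation of the second-kind
curvature from the Riemannian curvature. -/
def deviationForm (g : ContMDiffRiemannianMetric I ∞ E (fun x : M ↦ TangentSpace I x))
    (A : Π x : M, TangentSpace I x →L[ℝ] TangentSpace I x)
    (η : Π x : M, TangentSpace I x →L[ℝ] ℝ) (Z : Π x : M, TangentSpace I x) (x : M) :
    TangentSpace I x →L[ℝ] ℝ :=
  d% (fun y ↦ η y (Z y)) x - η x ∘L leviCivita g Z x + η x (Z x) • (η x ∘L A x)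

theorem dualConnection_dualConnection_apply {x : M} (hA : IsKahler g A) (hη : IsSmoothOneForm η)
    (hZ : IsSmoothField Z) (hY : MDiffAt (T% Y) x) (v : TangentSpace I x) :
    dualConnection (quarterSymmetric g A η)
        (fun y ↦ dualConnection (quarterSymmetric g A η) Z y (Y y)) x v
      = leviCivita g (fun y ↦ leviCivita g Z y (Y y)) x v
        - η x (Z x) • A x (leviCivita g Y x v) - d% (fun y ↦ η y (Z y)) x v • A x (Y x)
        - η x (leviCivita g Z x (Y x)) • A x v + (η x (Z x) * η x (A x (Y x))) • A x v := by
  have hf := mdifferentiableAt_oneForm_apply hη (hZ.mdifferentiableAt x)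
  have hAY := mdifferentiableAt_applyField hA.smooth hY
  -- The sign is absorbed into the scalar factor, so that additivity and the Leibniz rule apply
  -- directly.
  have hW : (fun y ↦ dualConnection (quarterSymmetric g A η) Z y (Y y))
      = (fun y ↦ leviCivita g Z y (Y y))
        + (-fun y ↦ η y (Z y)) • applyField A Y := by
    ext y
    rw [dualConnection_quarterSymmetric_apply]
    simp [applyField, sub_eq_add_neg]
  rw [dualConnection_quarterSymmetric_apply, hW,
    (leviCivita g).isCovariantDerivativeOnUniv.add (mdifferentiableAt_leviCivita_apply hZ hY)
      (hf.neg.smul_section hAY),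
    (leviCivita g).isCovariantDerivativeOnUniv.leibniz hAY hf.neg, mvfderiv_neg]
  have hp := sub_eq_zero.1 (hA.parallel x Y hY v)
  simp only [add_apply, smul_apply, ContinuousLinearMap.smulRight_apply, hp, Pi.neg_apply,
    neg_apply, applyField, dualConnection_quarterSymmetric_apply, map_sub, map_smul, smul_eq_mul]
  module

/-- Antisymmetrize the second derivative above in `X` and `Y`. Only `Z` is taken smooth: `X` and `Y`
are merely differentiable at `x`, the generality in which tensoriality in `X` is tested. -/
theorem curvatureSecondKind_quarterSymmetric {x : M} (hA : IsKahler g A)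
    (hη : IsSmoothOneForm η) (hX : MDiffAt (T% X) x) (hY : MDiffAt (T% Y) x)
    (hZ : IsSmoothField Z) :
    curvatureSecondKind (quarterSymmetric g A η) X Y Z x
      = curvature (leviCivita g) X Y Z x + deviationForm g A η Z x (Y x) • A x (X x)
        - deviationForm g A η Z x (X x) • A x (Y x) := by
  simp only [curvatureSecondKind, curvature]
  rw [dualConnection_dualConnection_apply hA hη hZ hY,
    dualConnection_dualConnection_apply hA hη hZ hX, dualConnection_quarterSymmetric_apply,
    -- With `[X, Y] = ∇_X Y - ∇_Y X`, the terms `η(Z) A∇_X Y` and `η(Z) A∇_Y X` cancel against `η(Z)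
    -- A[X, Y]`.
    ← (CovariantDerivative.torsion_eq_zero_iff _).1 (leviCivita_torsion g) hX hY]
  simp only [deviationForm, add_apply, sub_apply, smul_apply, ContinuousLinearMap.comp_apply,
    map_sub, smul_eq_mul]
  module

/-! ### Traces and the Ricci tensor of the second kind -/

theorem trace_eq_zero_of_isAlmostHermitian (hA : IsAlmostHermitian g A) (x : M) :
    LinearMap.trace ℝ (TangentSpace I x) (A x).toLinearMap = 0 := by
  let F : TangentSpace I x ≃ₗ[ℝ] Module.Dual ℝ (TangentSpace I x) :=
    (flat g x).trans LinearMap.toContinuousLinearMap.symm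
  have hF : ∀ v w, F v w = g.inner x v w := fun _ _ ↦ rfl
  -- Invariance of `g` and `A² = -1` give `g(v, Aw) = -g(Av, w)`. So the transpose of `A` is
  -- conjugate to `-A`, whence `tr A = -tr A`.
  have hskew : Module.Dual.transpose (A x).toLinearMap = F.conj (-(A x).toLinearMap) := by
    ext φ w
    obtain ⟨v, rfl⟩ := F.surjective φ
    have h := hA.inner x v (A x w)
    rw [hA.sq, map_neg] at h
    simp only [LinearEquiv.conj_apply, LinearMap.comp_apply, LinearEquiv.coe_coe,
      LinearEquiv.symm_apply_apply, LinearMap.neg_apply, Module.Dual.transpose_apply,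
      ContinuousLinearMap.coe_coe, hF, map_neg]
    linarith
  have h1 := LinearMap.trace_transpose' (R := ℝ) (A x).toLinearMap
  rw [hskew, LinearMap.trace_conj', map_neg] at h1
  linarith

theorem ricciSecondKind_quarterSymmetric (hA : IsKahler g A) (hη : IsSmoothOneForm η)
    (hY : IsSmoothField Y) (hZ : IsSmoothField Z) (x : M) :
    ricciSecondKind (quarterSymmetric g A η) Y Z x
      = ricci (leviCivita g) Y Z x - deviationForm g A η Z x (A x (Y x)) := by
  have hR := curvature_tensorialAt (leviCivita g) hY hZ x
  have hform : ∀ {X : Π x : M, TangentSpace I x}, MDiffAt (T% X) x →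
      curvatureSecondKind (quarterSymmetric g A η) X Y Z x = _ :=
    fun hX ↦ curvatureSecondKind_quarterSymmetric hA hη hX (hY.mdifferentiableAt x) hZ
  -- Without tensoriality `tensorTrace` would take its default value 0. It is inherited from `R`,
  -- because the correction terms are pointwise linear in `X`.
  have hR2 : TensorialAt I E
      (fun X ↦ curvatureSecondKind (quarterSymmetric g A η) X Y Z x) x := by
    constructor
    · intro f X hf hX
      rw [hform hX, hform (hf.smul_section hX), hR.smul hf hX]
      simp only [Pi.smul_apply', map_smul, smul_eq_mul]
      module
    · intro X X' hX hX'
      rw [hform hX, hform hX', hform (mdifferentiableAt_add_section hX hX'), hR.add hX hX']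
      simp only [Pi.add_apply, map_add]
      module
  rw [ricciSecondKind, ricci, tensorTrace, tensorTrace, dif_pos hR2, dif_pos hR]
  -- The summands have traces `Ric(Y, Z)`, `ω(Y) tr A = 0` and, for the rank-one map, `ω(AY)`.
  have hhom : (TensorialAt.mkHom _ x hR2).toLinearMap = (TensorialAt.mkHom _ x hR).toLinearMap
      + deviationForm g A η Z x (Y x) • (A x).toLinearMap
      - (deviationForm g A η Z x).toLinearMap.smulRight (A x (Y x)) := by
    ext v
    have hv := mdifferentiableAt_extend I E v
    have h2 := TensorialAt.mkHom_apply hR2 hv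
    have h1 := TensorialAt.mkHom_apply hR hv
    rw [hform hv] at h2
    simp only [extend_apply_self] at h1 h2
    simp only [ContinuousLinearMap.coe_coe, LinearMap.sub_apply, LinearMap.add_apply,
      LinearMap.smul_apply, LinearMap.smulRight_apply]
    rw [h2, h1]
  rw [hhom, map_sub, map_add, map_smul, trace_eq_zero_of_isAlmostHermitian hA.toIsAlmostHermitian,
    LinearMap.trace_smulRight]
  simp

/-- The tensor `H²` of a quarter-symmetric connection on a Kähler manifold does not involve the
generator. -/
theorem tensorH2_eq (hA : IsKahler g A) (hη : IsSmoothOneForm η) (hX : IsSmoothField X)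
    (hY : IsSmoothField Y) (hZ : IsSmoothField Z) (x : M) :
    tensorH2 g A η X Y Z x = curvature (leviCivita g) X Y Z x
      + ricci (leviCivita g) (applyField A X) Z x • A x (Y x)
      - ricci (leviCivita g) (applyField A Y) Z x • A x (X x) := by
  rw [tensorH2, curvatureSecondKind_quarterSymmetric hA hη (hX.mdifferentiableAt x)
      (hY.mdifferentiableAt x) hZ,
    ricciSecondKind_quarterSymmetric hA hη (isSmoothField_applyField hA.smooth hX) hZ,
    ricciSecondKind_quarterSymmetric hA hη (isSmoothField_applyField hA.smooth hY) hZ]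
  -- `-ω(A(AX)) = ω(X)`: the Ricci corrections become the negatives of the curvature corrections.
  simp only [applyField, hA.sq, map_neg]
  module

end Kahler

end QuarterSymmetric

end

theorem mainTheorem9 (n : ℕ) (M : Type*) [TopologicalSpace M]
    [ChartedSpace (EuclideanSpace ℝ (Fin n)) M] [IsManifold (𝓡 n) ∞ M]
    (g : ContMDiffRiemannianMetric (𝓡 n) ∞ (EuclideanSpace ℝ (Fin n))
      (fun x : M ↦ TangentSpace (𝓡 n) x))
    (A : (x : M) → TangentSpace (𝓡 n) x →L[ℝ] TangentSpace (𝓡 n) x)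
    (hA : QuarterSymmetric.IsKahler g A) :
    (∀ η η' : (x : M) → TangentSpace (𝓡 n) x →L[ℝ] ℝ,
      QuarterSymmetric.IsSmoothOneForm η → QuarterSymmetric.IsSmoothOneForm η' →
      ∀ X Y Z : (x : M) → TangentSpace (𝓡 n) x, QuarterSymmetric.IsSmoothField X →
        QuarterSymmetric.IsSmoothField Y → QuarterSymmetric.IsSmoothField Z → ∀ x : M,
        QuarterSymmetric.tensorH2 g A η X Y Z x = QuarterSymmetric.tensorH2 g A η' X Y Z x) ∧
    (∀ η : (x : M) → TangentSpace (𝓡 n) x →L[ℝ] ℝ, QuarterSymmetric.IsSmoothOneForm η →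
      ∀ X Y Z : (x : M) → TangentSpace (𝓡 n) x, QuarterSymmetric.IsSmoothField X →
        QuarterSymmetric.IsSmoothField Y → QuarterSymmetric.IsSmoothField Z → ∀ x : M,
        QuarterSymmetric.tensorH2 g A η X Y Z x =
          QuarterSymmetric.curvature (QuarterSymmetric.leviCivita g) X Y Z x
            + QuarterSymmetric.ricci (QuarterSymmetric.leviCivita g)
                (QuarterSymmetric.applyField A X) Z x • A x (Y x)
            - QuarterSymmetric.ricci (QuarterSymmetric.leviCivita g)
                (QuarterSymmetric.applyField A Y) Z x • A x (X x)) := by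
  have key := fun (η : (x : M) → TangentSpace (𝓡 n) x →L[ℝ] ℝ)
      (hη : QuarterSymmetric.IsSmoothOneForm η) (X Y Z : (x : M) → TangentSpace (𝓡 n) x)
      (hX : QuarterSymmetric.IsSmoothField X) (hY : QuarterSymmetric.IsSmoothField Y)
      (hZ : QuarterSymmetric.IsSmoothField Z) (x : M) ↦
    QuarterSymmetric.tensorH2_eq hA hη hX hY hZ x
  exact ⟨fun η η' hη hη' X Y Z hX hY hZ x ↦
    (key η hη X Y Z hX hY hZ x).trans (key η' hη' X Y Z hX hY hZ x).symm, key⟩
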